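/- For an integer $n\ge 1$ let $\mathcal D_n$ be the set of positive semidefinite matrices $D\in M_n(\mathbb C)$ all of whose diagonal entries are at most $1$, and let $\mathcal R_n$ be the closed convex hull in $M_n(\mathbb C)$ of the positive semidefinite matrices of rank one all of whose diagonal entries equal $1$. Then $4/\pi$ is the smallest positive real number $c$ with the following property: for every integer $n\ge 1$ and every $D\in\mathcal D_n$ there exists $R\in\mathcal R_n$ with $D\le cR$, that is, such that $cR-D$ is positive semidefinite. -/

import Mathlib

open scoped ComplexOrder MatrixOrder

/-- The set `𝓓ₙ` of positive semidefinite complex matrices whose diagonal entries are at most 1. -/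
def setD (n : ℕ) : Set (Matrix (Fin n) (Fin n) ℂ) :=
  {D | D.PosSemidef ∧ ∀ i, D i i ≤ 1}

/-- The positive semidefinite matrices of rank one with all diagonal entries equal to 1. -/
def unitDiagRankOne (n : ℕ) : Set (Matrix (Fin n) (Fin n) ℂ) :=
  {P | P.PosSemidef ∧ P.rank = 1 ∧ ∀ i, P i i = 1}

/-- The set `𝓡ₙ`: the closed convex hull of the positive rank one matrices with unit diagonal. -/
def setR (n : ℕ) : Set (Matrix (Fin n) (Fin n) ℂ) :=
  closedConvexHull ℝ (unitDiagRankOne n)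

open MeasureTheory ProbabilityTheory
open scoped Matrix

/-! Both bounds come from a standard Gaussian vector `x` in `ℂ^m`, normalised so that a unit
coordinate `z` has `E|z|² = 2` and `E|z| = κ = √(π/2)`.

Upper bound: raise the diagonal of `D` to 1 and write `D` as a Gram matrix of unit vectors `u i`.
Let `R` average the rank one matrices of the phases of `⟪u i, x⟫`. A phase correlates with another
coordinate by the factor `κ` (`integral_re_star_unitPhase_mul_inner`); completing a square turns
this into `D ≤ (4/π) R` (`pi_div_four_mul_norm_sq_le_integral`).

Lower bound: take the Gram matrix of the directions of a discretised Gaussian vector in `ℂ^d`, and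
test `D ≤ cR` on a sum of quadratic forms weighted by probability times length. Up to discretisation
error, the Gram side is at least `(E‖x‖)²/d` and every `R` gives at most `κ²`, so `(E‖x‖)² ≤ d c
π/2`. Since `E‖x‖ ~ √(2d)`, letting `d → ∞` gives `c ≥ 4/π`. -/

/-! ### The standard Gaussian on `ℂ` and linear functionals -/

/-- The real inner product of a complex Euclidean space is the real part of the complex one. -/
lemma EuclideanSpace.real_inner_eq_re_inner_complex {ι : Type*} [Fintype ι]
    (x y : EuclideanSpace ℂ ι) : inner ℝ x y = (inner ℂ x y).re := by
  simp [PiLp.inner_apply, Complex.inner]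

/-- Under the standard Gaussian, the linear functional `⟪v, ·⟫` is distributed as `‖v‖ z` with `z`
a standard Gaussian on `ℂ`. -/
lemma map_inner_stdGaussian {ι : Type*} [Fintype ι] (v : EuclideanSpace ℂ ι) :
    (stdGaussian (EuclideanSpace ℂ ι)).map (fun x ↦ inner ℂ v x) =
      (stdGaussian ℂ).map (fun z ↦ ‖v‖ • z) := by
  have h1 : Measurable (fun x : EuclideanSpace ℂ ι ↦ inner ℂ v x) := by fun_prop
  have h2 : Measurable (fun z : ℂ ↦ ‖v‖ • z) := by fun_prop
  have := Measure.isProbabilityMeasure_map (μ := stdGaussian (EuclideanSpace ℂ ι)) h1.aemeasurable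
  have := Measure.isProbabilityMeasure_map (μ := stdGaussian ℂ) h2.aemeasurable
  apply Measure.ext_of_charFun
  ext t
  rw [charFun_apply, charFun_apply, integral_map h1.aemeasurable (by fun_prop),
    integral_map h2.aemeasurable (by fun_prop)]
  have e1 : ∀ x : EuclideanSpace ℂ ι, inner ℝ (inner ℂ v x) t = inner ℝ x (t • v) := by
    intro x
    rw [EuclideanSpace.real_inner_eq_re_inner_complex, inner_smul_right, ← inner_conj_symm v x,
      Complex.inner]
    simp
  have e2 : ∀ z : ℂ, inner ℝ (‖v‖ • z) t = inner ℝ z (‖v‖ • t) := by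
    intro z; rw [real_inner_smul_left, real_inner_smul_right]
  simp_rw [e1, e2]
  rw [← charFun_apply, ← charFun_apply, charFun_stdGaussian, charFun_stdGaussian]
  congr 3
  rw [norm_smul, norm_smul, norm_norm, mul_comm]

lemma integral_comp_inner_stdGaussian {ι : Type*} [Fintype ι] (v : EuclideanSpace ℂ ι)
    {f : ℂ → ℝ} (hf : Continuous f) :
    ∫ x, f (inner ℂ v x) ∂(stdGaussian (EuclideanSpace ℂ ι)) =
      ∫ z, f (‖v‖ • z) ∂(stdGaussian ℂ) := by
  rw [← integral_map (φ := fun x : EuclideanSpace ℂ ι ↦ inner ℂ v x) (by fun_prop)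
    (by fun_prop), map_inner_stdGaussian, integral_map (by fun_prop) (by fun_prop)]

lemma lintegral_gaussianDensity_complex :
    ∫⁻ z : ℂ, ENNReal.ofReal ((2 * Real.pi)⁻¹ * Real.exp (-(1 / 2) * ‖z‖ ^ 2)) = 1 := by
  have h := GaussianFourier.integral_rexp_neg_mul_sq_norm (V := ℂ) (b := 1 / 2) (by norm_num)
  have hi : Integrable (fun z : ℂ ↦ Real.exp (-(1 / 2) * ‖z‖ ^ 2)) := by
    -- Without integrability the integral would be 0 by convention, against its positive value.
    by_contra hn
    rw [integral_undef hn] at h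
    have : (0 : ℝ) < (Real.pi / (1 / 2)) ^ ((Module.finrank ℝ ℂ : ℝ) / 2) := by positivity
    linarith
  rw [← ofReal_integral_eq_lintegral_ofReal (hi.const_mul _)
    (Filter.Eventually.of_forall fun z ↦ by positivity), integral_const_mul, h]
  rw [Complex.finrank_real_complex]
  norm_num
  field_simp

/-- The standard Gaussian measure on `ℂ` has density `exp (-‖z‖² / 2) / (2π)`. -/
lemma stdGaussian_complex_eq_withDensity :
    stdGaussian ℂ = volume.withDensity
      (fun z : ℂ ↦ ENNReal.ofReal ((2 * Real.pi)⁻¹ * Real.exp (-(1 / 2) * ‖z‖ ^ 2))) := by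
  have hfin : IsProbabilityMeasure (volume.withDensity
      (fun z : ℂ ↦ ENNReal.ofReal ((2 * Real.pi)⁻¹ * Real.exp (-(1 / 2) * ‖z‖ ^ 2)))) :=
    ⟨by
      rw [withDensity_apply _ MeasurableSet.univ, Measure.restrict_univ,
        lintegral_gaussianDensity_complex]⟩
  apply Measure.ext_of_charFun
  ext t
  rw [charFun_stdGaussian, charFun_apply, integral_withDensity_eq_integral_toReal_smul
    (by fun_prop) (by simp)]
  have h := GaussianFourier.integral_cexp_neg_mul_sq_norm_add (V := ℂ) (b := 1 / 2)
    (by norm_num) Complex.I t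
  have e : ∀ z : ℂ, (ENNReal.ofReal ((2 * Real.pi)⁻¹ * Real.exp (-(1 / 2) * ‖z‖ ^ 2))).toReal •
      Complex.exp (inner ℝ z t * Complex.I) = ((2 * Real.pi)⁻¹ : ℂ) *
        Complex.exp (-(1 / 2) * (‖z‖ : ℂ) ^ 2 + Complex.I * inner ℝ t z) := by
    intro z
    rw [ENNReal.toReal_ofReal (by positivity), Complex.exp_add, Complex.real_smul,
      real_inner_comm]
    push_cast
    ring_nf
  simp_rw [e]
  rw [integral_const_mul, h, Complex.finrank_real_complex]
  have hp : (Real.pi : ℂ) ≠ 0 := by exact_mod_cast Real.pi_ne_zero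
  norm_num
  field_simp

lemma integral_norm_stdGaussian_complex :
    ∫ z, ‖z‖ ∂(stdGaussian ℂ) = √(Real.pi / 2) := by
  rw [stdGaussian_complex_eq_withDensity, integral_withDensity_eq_integral_toReal_smul
    (by fun_prop) (by simp)]
  have h := Complex.integral_rpow_mul_exp_neg_mul_rpow (p := 2) (q := 1) (b := 1 / 2)
    (by norm_num) (by norm_num) (by norm_num)
  have e : ∀ z : ℂ, (ENNReal.ofReal ((2 * Real.pi)⁻¹ * Real.exp (-(1 / 2) * ‖z‖ ^ 2))).toReal •
      ‖z‖ = (2 * Real.pi)⁻¹ * (‖z‖ ^ (1 : ℝ) * Real.exp (-(1 / 2) * ‖z‖ ^ (2 : ℝ))) := by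
    intro z
    rw [ENNReal.toReal_ofReal (by positivity), Real.rpow_one, Real.rpow_two, smul_eq_mul]
    ring
  simp_rw [e]
  rw [integral_const_mul, h]
  have e3 : Real.Gamma ((1 + 2) / 2) = √Real.pi / 2 := by
    rw [show ((1 : ℝ) + 2) / 2 = 1 / 2 + 1 by norm_num, Real.Gamma_add_one (by norm_num),
      Real.Gamma_one_half_eq]
    ring
  have e4 : ((1 : ℝ) / 2) ^ (-(1 + 2 : ℝ) / 2) = 2 * √2 := by
    rw [one_div, Real.inv_rpow (by norm_num), ← Real.rpow_neg (by norm_num),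
      show -(-(1 + 2 : ℝ) / 2) = 1 + 1 / 2 by norm_num, Real.rpow_add (by norm_num),
      Real.rpow_one, ← Real.sqrt_eq_rpow]
  rw [e3, e4, Real.sqrt_div Real.pi_pos.le]
  have h2 : √2 * √2 = (2 : ℝ) := Real.mul_self_sqrt (by norm_num)
  field_simp
  nlinarith [h2]

/-! ### Moments and concentration of the norm -/

lemma memLp_stdGaussian {E : Type*} [NormedAddCommGroup E] [InnerProductSpace ℝ E]
    [FiniteDimensional ℝ E] [MeasurableSpace E] [BorelSpace E] (p : ENNReal) (hp : p ≠ ⊤) :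
    MemLp (fun x : E ↦ x) p (stdGaussian E) :=
  IsGaussian.memLp_id _ p hp

lemma integrable_norm_pow_stdGaussian {E : Type*} [NormedAddCommGroup E] [InnerProductSpace ℝ E]
    [FiniteDimensional ℝ E] [MeasurableSpace E] [BorelSpace E] (k : ℕ) :
    Integrable (fun x : E ↦ ‖x‖ ^ k) (stdGaussian E) := by
  rcases eq_or_ne k 0 with rfl | hk
  · simp
  · exact (memLp_stdGaussian (k : ENNReal) (by simp)).integrable_norm_pow hk

lemma memLp_sq_gaussianReal : MemLp (fun t : ℝ ↦ t ^ 2) 2 (gaussianReal 0 1) := by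
  have h : MemLp (fun t : ℝ ↦ t) 4 (gaussianReal 0 1) := IsGaussian.memLp_id _ 4 (by simp)
  rw [memLp_two_iff_integrable_sq (by fun_prop)]
  have := h.integrable_norm_pow (p := 4) (by norm_num)
  refine this.congr (Filter.Eventually.of_forall fun t ↦ ?_)
  simp only [Real.norm_eq_abs]
  rw [← pow_mul]
  exact (Even.pow_abs (by decide) t)

lemma norm_sq_sum_smul_basis (E : Type*) [NormedAddCommGroup E] [InnerProductSpace ℝ E]
    [FiniteDimensional ℝ E] (x : Fin (Module.finrank ℝ E) → ℝ) :
    ‖∑ i, x i • stdOrthonormalBasis ℝ E i‖ ^ 2 = ∑ i, x i ^ 2 := by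
  rw [← (stdOrthonormalBasis ℝ E).sum_sq_inner_right]
  refine Finset.sum_congr rfl fun i _ ↦ ?_
  rw [(stdOrthonormalBasis ℝ E).orthonormal.inner_right_fintype]

lemma integral_sq_gaussianReal : ∫ t, t ^ 2 ∂(gaussianReal 0 1) = 1 := by
  have h := variance_id_gaussianReal (μ := 0) (v := 1)
  rw [variance_eq_integral (by fun_prop)] at h
  simpa using h

section moments

variable (E : Type*) [NormedAddCommGroup E] [InnerProductSpace ℝ E]
    [FiniteDimensional ℝ E] [MeasurableSpace E] [BorelSpace E]

lemma integral_norm_sq_stdGaussian :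
    ∫ x, ‖x‖ ^ 2 ∂(stdGaussian E) = Module.finrank ℝ E := by
  rw [stdGaussian, integral_map (Measurable.aemeasurable (by fun_prop)) (by fun_prop)]
  simp_rw [norm_sq_sum_smul_basis]
  rw [integral_finsetSum]
  · have : ∀ i : Fin (Module.finrank ℝ E), ∫ x : Fin (Module.finrank ℝ E) → ℝ, x i ^ 2
        ∂(Measure.pi fun _ ↦ gaussianReal 0 1) = 1 := fun i ↦ by
      rw [← integral_sq_gaussianReal]
      exact integral_comp_eval (μ := fun _ ↦ gaussianReal 0 1) (i := i)
        (f := fun t : ℝ ↦ t ^ 2) (by fun_prop)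
    simp [this]
  · intro i _
    exact integrable_comp_eval (μ := fun _ ↦ gaussianReal 0 1) (i := i)
        (f := fun t : ℝ ↦ t ^ 2) (memLp_sq_gaussianReal.integrable (by norm_num))

/-- `‖x‖²` is a sum of independent squares, so its variances add; the second moment is the variance
plus the squared mean. -/
lemma integral_norm_pow_four_stdGaussian :
    ∫ x, ‖x‖ ^ 4 ∂(stdGaussian E) = (Module.finrank ℝ E : ℝ) ^ 2 +
      Module.finrank ℝ E * Var[fun t ↦ t ^ 2; gaussianReal 0 1] := by
  have h4 : ∀ y : E, ‖y‖ ^ 4 = (‖y‖ ^ 2) ^ 2 := fun y ↦ by ring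
  have hi := integral_norm_sq_stdGaussian E
  rw [stdGaussian, integral_map (Measurable.aemeasurable (by fun_prop)) (by fun_prop)] at hi ⊢
  simp_rw [h4, norm_sq_sum_smul_basis] at hi ⊢
  have hv := variance_sum_pi (μ := fun _ : Fin (Module.finrank ℝ E) ↦ gaussianReal 0 1)
    (X := fun _ t ↦ t ^ 2) (fun _ ↦ memLp_sq_gaussianReal)
  rw [variance_eq_sub] at hv
  · simp only [Finset.sum_const, Finset.card_univ, Fintype.card_fin, nsmul_eq_mul] at hv
    have e : (∑ i : Fin (Module.finrank ℝ E), fun ω : Fin (Module.finrank ℝ E) → ℝ ↦ ω i ^ 2) =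
        fun ω ↦ ∑ i, ω i ^ 2 := by ext; simp
    rw [e, hi] at hv
    simp only [Pi.pow_apply] at hv
    linarith
  · refine memLp_finsetSum' _ fun i _ ↦ ?_
    exact memLp_sq_gaussianReal.comp_measurePreserving (measurePreserving_eval _ i)

/-- The norm of a standard Gaussian vector concentrates: its mean is at least
`√m (1 - V / (2m))` in dimension `m`, for a constant `V`. -/
lemma sqrt_finrank_mul_le_integral_norm_stdGaussian (hm : 0 < Module.finrank ℝ E) :
    √(Module.finrank ℝ E) *
        (1 - Var[fun t ↦ t ^ 2; gaussianReal 0 1] / (2 * Module.finrank ℝ E)) ≤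
      ∫ x, ‖x‖ ∂(stdGaussian E) := by
  have hi2 := integral_norm_sq_stdGaussian E
  have hi4 := integral_norm_pow_four_stdGaussian E
  set V := Var[fun t ↦ t ^ 2; gaussianReal 0 1]
  have hm' : (0 : ℝ) < Module.finrank ℝ E := by exact_mod_cast hm
  set m : ℝ := (Module.finrank ℝ E : ℝ)
  have hs : 0 < √m := Real.sqrt_pos.2 hm'
  have hsm : √m ^ 2 = m := Real.sq_sqrt hm'.le
  -- With `t = ‖x‖/√m` this is `(3t² - t⁴)/2 ≤ t`, tangent at `t = 1`: twice the gap is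
  -- `t(t-1)²(t+2)`.
  have key : ∀ x : E, √m / 2 * (3 / m * ‖x‖ ^ 2 - 1 / m ^ 2 * ‖x‖ ^ 4) ≤ ‖x‖ := by
    intro x
    obtain ⟨t, ht⟩ : ∃ t, t = ‖x‖ / √m := ⟨_, rfl⟩
    have ht0 : 0 ≤ t := by rw [ht]; positivity
    have hx : ‖x‖ = t * √m := by rw [ht]; field_simp
    have e : 3 / m * ‖x‖ ^ 2 - 1 / m ^ 2 * ‖x‖ ^ 4 = 3 * t ^ 2 - t ^ 4 := by
      rw [hx, mul_pow, mul_pow, show √m ^ 4 = (√m ^ 2) ^ 2 by ring, hsm]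
      field_simp
    rw [e, hx]
    have : 0 ≤ √m / 2 * (t * (t - 1) ^ 2 * (t + 2)) := by positivity
    nlinarith [this]
  have hint := integral_mono (μ := stdGaussian E)
    ((((integrable_norm_pow_stdGaussian 2).const_mul (3 / m)).sub
      ((integrable_norm_pow_stdGaussian 4).const_mul (1 / m ^ 2))).const_mul (√m / 2))
    (by simpa using integrable_norm_pow_stdGaussian (E := E) 1) key
  rw [integral_const_mul, integral_sub' ((integrable_norm_pow_stdGaussian 2).const_mul _)
    ((integrable_norm_pow_stdGaussian 4).const_mul _), integral_const_mul, integral_const_mul,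
    hi2, hi4] at hint
  refine le_trans (le_of_eq ?_) hint
  field_simp
  ring

end moments

/-! ### Gaussian coordinates and their phases -/

section inner

variable {ι : Type*} [Fintype ι]

lemma integral_norm_inner_stdGaussian (v : EuclideanSpace ℂ ι) :
    ∫ x, ‖inner ℂ v x‖ ∂(stdGaussian (EuclideanSpace ℂ ι)) = √(Real.pi / 2) * ‖v‖ := by
  rw [integral_comp_inner_stdGaussian v continuous_norm]
  simp_rw [norm_smul, norm_norm]
  rw [integral_const_mul, integral_norm_stdGaussian_complex, mul_comm]

lemma integral_norm_inner_sq_stdGaussian (v : EuclideanSpace ℂ ι) :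
    ∫ x, ‖inner ℂ v x‖ ^ 2 ∂(stdGaussian (EuclideanSpace ℂ ι)) = 2 * ‖v‖ ^ 2 := by
  rw [integral_comp_inner_stdGaussian v (f := fun z ↦ ‖z‖ ^ 2) (by fun_prop)]
  simp_rw [norm_smul, norm_norm, mul_pow]
  rw [integral_const_mul, integral_norm_sq_stdGaussian, Complex.finrank_real_complex, mul_comm]
  norm_num

lemma memLp_inner_stdGaussian (v : EuclideanSpace ℂ ι) :
    MemLp (fun x ↦ inner ℂ v x) 2 (stdGaussian (EuclideanSpace ℂ ι)) :=
  (memLp_stdGaussian 2 (by simp)).continuousLinearMap_comp (innerSL ℂ v)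

lemma integrable_inner_stdGaussian (v : EuclideanSpace ℂ ι) :
    Integrable (fun x ↦ inner ℂ v x) (stdGaussian (EuclideanSpace ℂ ι)) :=
  (memLp_inner_stdGaussian v).integrable (by norm_num)

end inner

lemma inner_self_eq_ofReal_norm_sq {E : Type*} [NormedAddCommGroup E] [InnerProductSpace ℂ E]
    (x : E) : inner ℂ x x = ((‖x‖ ^ 2 : ℝ) : ℂ) := by
  rw [inner_self_eq_norm_sq_to_K]
  simp

/-- The phase `z / ‖z‖` of a complex number, equal to `1` at `0`. -/
noncomputable def unitPhase (z : ℂ) : ℂ := if z = 0 then 1 else z / ‖z‖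

@[simp]
lemma norm_unitPhase (z : ℂ) : ‖unitPhase z‖ = 1 := by
  unfold unitPhase
  split_ifs with h
  · simp
  · simp [h]

lemma star_unitPhase_mul_self (z : ℂ) : star (unitPhase z) * z = ‖z‖ := by
  unfold unitPhase
  split_ifs with h
  · simp [h]
  · have : (‖z‖ : ℂ) ≠ 0 := by simpa using h
    simp only [RCLike.star_def, map_div₀, Complex.conj_ofReal]
    rw [div_mul_eq_mul_div, Complex.conj_mul', pow_two, mul_div_assoc, div_self this, mul_one]

lemma unitPhase_mul_star_self (z : ℂ) : unitPhase z * star (unitPhase z) = 1 := by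
  rw [RCLike.star_def, Complex.mul_conj']
  simp

@[fun_prop]
lemma measurable_unitPhase : Measurable unitPhase :=
  Measurable.ite (measurableSet_singleton 0) measurable_const (by fun_prop)

section

variable {ι : Type*} [Fintype ι]

lemma integrable_star_unitPhase_mul_inner (v w : EuclideanSpace ℂ ι) :
    Integrable (fun x ↦ star (unitPhase (inner ℂ v x)) * inner ℂ w x)
      (stdGaussian (EuclideanSpace ℂ ι)) := by
  refine (integrable_inner_stdGaussian w).bdd_mul (c := 1) ?_ ?_
  · exact Measurable.aestronglyMeasurable
      (continuous_star.measurable.comp (measurable_unitPhase.comp (by fun_prop)))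
  · exact Filter.Eventually.of_forall fun x ↦ by simp

/-- The correlation of the phase of one Gaussian coordinate with another Gaussian coordinate. -/
lemma integral_re_star_unitPhase_mul_inner {v : EuclideanSpace ℂ ι} (hv : ‖v‖ = 1)
    (w : EuclideanSpace ℂ ι) :
    ∫ x, (star (unitPhase (inner ℂ v x)) * inner ℂ w x).re
      ∂(stdGaussian (EuclideanSpace ℂ ι)) = √(Real.pi / 2) * (inner ℂ v w).re := by
  set T := ∫ x, (star (unitPhase (inner ℂ v x)) * inner ℂ w x).re
      ∂(stdGaussian (EuclideanSpace ℂ ι))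
  set κ := √(Real.pi / 2)
  have hκ : 0 ≤ κ := Real.sqrt_nonneg _
  have hvi := (integrable_inner_stdGaussian v).norm
  have hTi := (integrable_star_unitPhase_mul_inner v w).re
  -- The phase of `⟪v, x⟫` is optimal at `t = 0` and only a competitor for `v + t • w`. So `T` is a
  -- slope at 0 of `t ↦ κ‖v + t • w‖`, which `upper` pins down to first order.
  have lower : ∀ t : ℝ, κ + t * T ≤ κ * ‖v + t • w‖ := by
    intro t
    have hp : ∀ x, ‖inner ℂ v x‖ + t * (star (unitPhase (inner ℂ v x)) * inner ℂ w x).re ≤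
        ‖inner ℂ (v + t • w) x‖ := by
      intro x
      have e : inner ℂ (v + t • w) x = inner ℂ v x + t * inner ℂ w x := by
        rw [inner_add_left, inner_smul_left_eq_smul, Complex.real_smul]
      have : ‖inner ℂ v x‖ + t * (star (unitPhase (inner ℂ v x)) * inner ℂ w x).re =
          (star (unitPhase (inner ℂ v x)) * inner ℂ (v + t • w) x).re := by
        rw [e, mul_add, star_unitPhase_mul_self, mul_left_comm]
        simp
      rw [this]
      refine (Complex.re_le_norm _).trans ?_
      simp
    have := integral_mono (hvi.add (hTi.const_mul t))
      (integrable_inner_stdGaussian (v + t • w)).norm hp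
    rw [integral_norm_inner_stdGaussian] at this
    refine le_trans (le_of_eq ?_) this
    rw [integral_add' hvi (hTi.const_mul t), integral_norm_inner_stdGaussian, hv, mul_one]
    congr 1
    exact (integral_const_mul _ _).symm
  have upper : ∀ t : ℝ, ‖v + t • w‖ ≤ 1 + t * (inner ℂ v w).re + t ^ 2 * ‖w‖ ^ 2 / 2 := by
    intro t
    have h := norm_add_sq_real v (t • w)
    rw [real_inner_smul_right, EuclideanSpace.real_inner_eq_re_inner_complex, norm_smul,
      mul_pow, hv, Real.norm_eq_abs, sq_abs] at h
    nlinarith [sq_nonneg (‖v + t • w‖ - 1)]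
  have main : ∀ t : ℝ, t * (T - κ * (inner ℂ v w).re) ≤ t ^ 2 * (κ * ‖w‖ ^ 2 / 2) := by
    intro t
    have := (lower t).trans (mul_le_mul_of_nonneg_left (upper t) hκ)
    linarith
  set A := T - κ * (inner ℂ v w).re with hA
  have hB : 0 ≤ κ * ‖w‖ ^ 2 / 2 := by positivity
  set B := κ * ‖w‖ ^ 2 / 2
  -- `tA ≤ t²B` for all real `t` forces `A = 0`; the `+ 1` covers `B = 0`.
  have h1 := main (A / (B + 1))
  have hA0 : A = 0 := by
    have hB1 : 0 < B + 1 := by linarith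
    rw [div_pow, div_mul_eq_mul_div, div_mul_eq_mul_div, div_le_div_iff₀ hB1 (by positivity)] at h1
    have h2 : A ^ 2 * (B + 1) ≤ 0 := by nlinarith [h1, hB1]
    nlinarith [sq_nonneg A]
  linarith

/-- Rounding Gaussian coordinates to their phases loses at most a factor `π / 4` in the
covariance. -/
lemma pi_div_four_mul_norm_sq_le_integral {n : ℕ} {v : Fin n → EuclideanSpace ℂ ι}
    (hv : ∀ i, ‖v i‖ = 1) (a : Fin n → ℂ) :
    Real.pi / 4 * ‖∑ i, a i • v i‖ ^ 2 ≤
      ∫ x, ‖∑ i, star (a i) * unitPhase (inner ℂ (v i) x)‖ ^ 2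
        ∂(stdGaussian (EuclideanSpace ℂ ι)) := by
  set W := ∑ i, a i • v i with hW
  set κ := √(Real.pi / 2) with hκ
  have hκ2 : κ ^ 2 = Real.pi / 2 := Real.sq_sqrt (by positivity)
  let S : EuclideanSpace ℂ ι → ℂ := fun x ↦ ∑ i, star (a i) * unitPhase (inner ℂ (v i) x)
  have hSm : Measurable S := by
    refine Finset.measurable_sum _ fun i _ ↦ ?_
    exact (measurable_unitPhase.comp (by fun_prop)).const_mul _
  have hSb : ∀ x, ‖S x‖ ≤ ∑ i, ‖a i‖ := fun x ↦
    (norm_sum_le _ _).trans (le_of_eq (by simp))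
  have hS2 : Integrable (fun x ↦ ‖S x‖ ^ 2) (stdGaussian (EuclideanSpace ℂ ι)) := by
    refine Integrable.of_bound (by fun_prop) ((∑ i, ‖a i‖) ^ 2) (Filter.Eventually.of_forall
      fun x ↦ ?_)
    rw [Real.norm_of_nonneg (by positivity)]
    exact pow_le_pow_left₀ (norm_nonneg _) (hSb x) 2
  have hexp : ∀ x, (star (S x) * inner ℂ W x).re =
      ∑ i, (star (unitPhase (inner ℂ (v i) x)) * inner ℂ (star (a i) • W) x).re := by
    intro x
    simp only [S, star_sum, Finset.sum_mul, Complex.re_sum, inner_smul_left]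
    refine Finset.sum_congr rfl fun i _ ↦ ?_
    simp
    ring
  have hint : ∀ i, Integrable (fun x ↦
      (star (unitPhase (inner ℂ (v i) x)) * inner ℂ (star (a i) • W) x).re)
      (stdGaussian (EuclideanSpace ℂ ι)) := fun i ↦
    (integrable_star_unitPhase_mul_inner _ _).re
  have hcross : ∫ x, (star (S x) * inner ℂ W x).re ∂(stdGaussian (EuclideanSpace ℂ ι)) =
      κ * ‖W‖ ^ 2 := by
    simp_rw [hexp]
    rw [integral_finsetSum _ fun i _ ↦ hint i]
    simp_rw [fun i ↦ integral_re_star_unitPhase_mul_inner (hv i)]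
    rw [← Finset.mul_sum, ← Complex.re_sum]
    congr 1
    have : ∑ i, inner ℂ (v i) (star (a i) • W) = inner ℂ W W := by
      conv_rhs => rw [hW, sum_inner]
      refine Finset.sum_congr rfl fun i _ ↦ ?_
      rw [inner_smul_right, inner_smul_left, RCLike.star_def]
    rw [this, inner_self_eq_ofReal_norm_sq, Complex.ofReal_re]
  have hci : Integrable (fun x ↦ (star (S x) * inner ℂ W x).re)
      (stdGaussian (EuclideanSpace ℂ ι)) := by
    simp_rw [hexp]
    exact integrable_finsetSum _ fun i _ ↦ hint i
  have hW2 : Integrable (fun x ↦ ‖inner ℂ W x‖ ^ 2) (stdGaussian (EuclideanSpace ℂ ι)) :=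
    (memLp_inner_stdGaussian W).integrable_norm_pow (by norm_num)
  -- Expand `(‖S x‖ - λ‖⟪W, x⟫‖)² ≥ 0`. In the mean this yields `(2λκ - 2λ²)‖W‖²`, largest at `λ =
  -- κ/2`, where it is `(π/4)‖W‖²`.
  have hpt : ∀ x, κ * (star (S x) * inner ℂ W x).re - κ ^ 2 / 4 * ‖inner ℂ W x‖ ^ 2 ≤
      ‖S x‖ ^ 2 := by
    intro x
    have h1 : (star (S x) * inner ℂ W x).re ≤ ‖S x‖ * ‖inner ℂ W x‖ :=
      (Complex.re_le_norm _).trans (by simp)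
    have h2 := mul_le_mul_of_nonneg_left h1 (Real.sqrt_nonneg (Real.pi / 2))
    nlinarith [sq_nonneg (‖S x‖ - κ / 2 * ‖inner ℂ W x‖)]
  have := integral_mono ((hci.const_mul κ).sub (hW2.const_mul (κ ^ 2 / 4))) hS2 hpt
  rw [integral_sub' (hci.const_mul κ) (hW2.const_mul _), integral_const_mul, integral_const_mul,
    hcross, integral_norm_inner_sq_stdGaussian] at this
  refine le_trans (le_of_eq ?_) this
  linear_combination (-(1 / 2) * ‖W‖ ^ 2) * hκ2

end

/-! ### Upper bound: averaging the phase matrices -/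

section

variable {n : ℕ}

lemma isClosed_setR : IsClosed (setR n) := isClosed_closedConvexHull

lemma convex_setR : Convex ℝ (setR n) := convex_closedConvexHull

lemma rank_vecMulVec_star_of_ne_zero {s : Fin n → ℂ} (hs : s ≠ 0) :
    (Matrix.vecMulVec s (star s)).rank = 1 := by
  refine le_antisymm (Matrix.rank_vecMulVec_le _ _) ?_
  rw [Nat.one_le_iff_ne_zero, Ne, Matrix.rank, Submodule.finrank_eq_zero, LinearMap.range_eq_bot]
  intro h
  have h : Matrix.vecMulVec s (star s) = 0 := by
    refine (LinearEquiv.map_eq_zero_iff (Matrix.toLin' (R := ℂ))).1 ?_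
    rw [Matrix.toLin'_apply']
    exact h
  obtain ⟨i, hi⟩ := Function.ne_iff.1 hs
  have := congrFun (congrFun h i) i
  simp [Matrix.vecMulVec_apply] at this
  exact hi this

lemma vecMulVec_star_mem_unitDiagRankOne (hn : 1 ≤ n) {s : Fin n → ℂ}
    (hs : ∀ i, s i * star (s i) = 1) :
    Matrix.vecMulVec s (star s) ∈ unitDiagRankOne n := by
  refine ⟨Matrix.posSemidef_vecMulVec_self_star s, rank_vecMulVec_star_of_ne_zero ?_, fun i ↦ ?_⟩
  · intro h
    have := hs ⟨0, hn⟩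
    simp [h] at this
  · rw [Matrix.vecMulVec_apply]
    exact hs i

lemma setR_integral_mem {Ω : Type*} [MeasurableSpace Ω] {μ : Measure Ω} [IsProbabilityMeasure μ]
    {P : Ω → Fin n → Fin n → ℂ} (hP : Integrable P μ)
    (h : ∀ x, (Matrix.of (P x)) ∈ setR n) : Matrix.of (∫ x, P x ∂μ) ∈ setR n := by
  have hc : Convex ℝ {M : Fin n → Fin n → ℂ | Matrix.of M ∈ setR n} := convex_setR
  have hcl : IsClosed {M : Fin n → Fin n → ℂ | Matrix.of M ∈ setR n} := isClosed_setR
  exact hc.integral_mem hcl (Filter.Eventually.of_forall h) hP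

lemma dotProduct_mulVec_vecMulVec_star (s a : Fin n → ℂ) :
    star a ⬝ᵥ (Matrix.vecMulVec s (star s) *ᵥ a) = ((‖∑ i, star (a i) * s i‖ ^ 2 : ℝ) : ℂ) := by
  push_cast
  rw [← Complex.mul_conj', map_sum, Finset.sum_mul_sum]
  simp only [dotProduct, Matrix.mulVec, Matrix.vecMulVec_apply, Finset.mul_sum]
  refine Finset.sum_congr rfl fun i _ ↦ Finset.sum_congr rfl fun j _ ↦ ?_
  simp
  ring

/-- Read a decomposition `D = ∑ vₖ vₖ*` by rows; the conjugate appears because the inner product is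
conjugate-linear on the left. -/
lemma exists_gram_eq_of_posSemidef {D : Matrix (Fin n) (Fin n) ℂ} (hD : D.PosSemidef) :
    ∃ (m : ℕ) (u : Fin n → EuclideanSpace ℂ (Fin m)), D = Matrix.gram ℂ u := by
  obtain ⟨m, v, rfl⟩ := Matrix.posSemidef_iff_eq_sum_vecMulVec.1 hD
  refine ⟨m, fun i ↦ WithLp.toLp 2 fun k ↦ star (v k i), ?_⟩
  ext i j
  simp [Matrix.sum_apply, Matrix.vecMulVec_apply, PiLp.inner_apply, mul_comm]

/-- Every Gram matrix of unit vectors is dominated by `4 / π` times the average of the rank one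
matrices of phases of the associated Gaussian vector. -/
lemma exists_gram_le_smul {m : ℕ} (hn : 1 ≤ n) {u : Fin n → EuclideanSpace ℂ (Fin m)}
    (hu : ∀ i, ‖u i‖ = 1) : ∃ R ∈ setR n, Matrix.gram ℂ u ≤ (4 / Real.pi) • R := by
  let γ := stdGaussian (EuclideanSpace ℂ (Fin m))
  let s : EuclideanSpace ℂ (Fin m) → Fin n → ℂ := fun x i ↦ unitPhase (inner ℂ (u i) x)
  have hs : ∀ i, Measurable fun x ↦ s x i := fun i ↦ measurable_unitPhase.comp (by fun_prop)
  let P : EuclideanSpace ℂ (Fin m) → Fin n → Fin n → ℂ := fun x i j ↦ s x i * star (s x j)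
  have hPi : ∀ i j, Integrable (fun x ↦ P x i j) γ := by
    intro i j
    refine Integrable.of_bound (Measurable.aestronglyMeasurable ((hs i).mul
      (continuous_star.measurable.comp (hs j)))) 1 (Filter.Eventually.of_forall fun x ↦ ?_)
    simp [P, s]
  have hP1 : ∀ i, Integrable (fun x ↦ P x i) γ := fun i ↦ Integrable.of_eval (hPi i)
  have hP : Integrable P γ := Integrable.of_eval hP1
  have hPv : ∀ x, Matrix.of (P x) = Matrix.vecMulVec (s x) (star (s x)) := fun x ↦ rfl
  have hR := setR_integral_mem hP fun x ↦
    subset_closedConvexHull (hPv x ▸ vecMulVec_star_mem_unitDiagRankOne hn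
      fun i ↦ unitPhase_mul_star_self _)
  refine ⟨_, hR, ?_⟩
  have hRij : ∀ i j, (∫ x, P x ∂γ) i j = ∫ x, P x i j ∂γ := by
    intro i j
    rw [eval_integral hP1, eval_integral (hPi i)]
  have hquad : ∀ a : Fin n → ℂ, star a ⬝ᵥ (Matrix.of (∫ x, P x ∂γ) *ᵥ a) =
      ((∫ x, ‖∑ i, star (a i) * s x i‖ ^ 2 ∂γ : ℝ) : ℂ) := by
    intro a
    rw [← integral_complex_ofReal]
    have e : ∀ x, ((‖∑ i, star (a i) * s x i‖ ^ 2 : ℝ) : ℂ) =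
        ∑ i, ∑ j, star (a i) * (P x i j * a j) := by
      intro x
      rw [← dotProduct_mulVec_vecMulVec_star, ← hPv]
      simp [dotProduct, Matrix.mulVec, Finset.mul_sum]
    simp_rw [e]
    rw [integral_finsetSum _ fun i _ ↦ integrable_finsetSum _ fun j _ ↦
      ((hPi i j).mul_const _).const_mul _]
    simp only [dotProduct, Matrix.mulVec, Finset.mul_sum, Matrix.of_apply, hRij]
    refine Finset.sum_congr rfl fun i _ ↦ ?_
    rw [integral_finsetSum _ fun j _ ↦ ((hPi i j).mul_const _).const_mul _]
    refine Finset.sum_congr rfl fun j _ ↦ ?_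
    rw [integral_const_mul, integral_mul_const]
    rfl
  have hherm : (Matrix.of (∫ x, P x ∂γ)).IsHermitian := by
    ext i j
    rw [Matrix.conjTranspose_apply, Matrix.of_apply, Matrix.of_apply, hRij, hRij,
      RCLike.star_def, ← integral_conj]
    congr 1
    ext x
    simp [P, mul_comm]
  rw [Matrix.le_iff]
  refine Matrix.PosSemidef.of_dotProduct_mulVec_nonneg
    ((hherm.smul (IsSelfAdjoint.all _)).sub (Matrix.isHermitian_gram ℂ u)) fun a ↦ ?_
  rw [Matrix.sub_mulVec, Matrix.smul_mulVec, dotProduct_sub, dotProduct_smul, hquad,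
    Matrix.star_dotProduct_gram_mulVec, inner_self_eq_ofReal_norm_sq, Complex.real_smul]
  have h := pi_div_four_mul_norm_sq_le_integral hu a
  have h2 : ‖∑ i, a i • u i‖ ^ 2 ≤ 4 / Real.pi * ∫ x, ‖∑ i, star (a i) * s x i‖ ^ 2 ∂γ := by
    have := mul_le_mul_of_nonneg_left h (show 0 ≤ 4 / Real.pi by positivity)
    refine le_trans (le_of_eq ?_) this
    field_simp
  rw [sub_nonneg]
  exact_mod_cast h2

lemma exists_mem_setR_le_smul (hn : 1 ≤ n) {D : Matrix (Fin n) (Fin n) ℂ} (hD : D ∈ setD n) :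
    ∃ R ∈ setR n, D ≤ (4 / Real.pi) • R := by
  -- Adding this matrix only increases `D` and makes the diagonal 1.
  have hdiag : (Matrix.diagonal fun i ↦ 1 - D i i).PosSemidef :=
    Matrix.PosSemidef.diagonal fun i ↦ sub_nonneg.2 (hD.2 i)
  obtain ⟨m, u, hu⟩ := exists_gram_eq_of_posSemidef (hD.1.add hdiag)
  have hu1 : ∀ i, ‖u i‖ = 1 := by
    intro i
    have h := congrFun (congrFun hu i) i
    rw [Matrix.add_apply, Matrix.diagonal_apply_eq, add_sub_cancel, Matrix.gram_apply,
      inner_self_eq_ofReal_norm_sq] at h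
    have h2 : ‖u i‖ ^ 2 = 1 := by exact_mod_cast h.symm
    exact (pow_eq_one_iff_of_nonneg (norm_nonneg _) two_ne_zero).1 h2
  obtain ⟨R, hR, hle⟩ := exists_gram_le_smul hn hu1
  refine ⟨R, hR, le_trans ?_ hle⟩
  rw [← hu, Matrix.le_iff, add_sub_cancel_left]
  exact hdiag

end

/-! ### Lower bound: testing on quadratic forms -/

section

variable {n : ℕ}

lemma exists_eq_vecMulVec_of_rank_eq_one {P : Matrix (Fin n) (Fin n) ℂ} (hP : P.rank = 1) :
    ∃ a b : Fin n → ℂ, P = Matrix.vecMulVec a b := by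
  obtain ⟨v, -, hv⟩ := finrank_eq_one_iff'.1 hP
  choose b hb using fun j ↦ hv ⟨P *ᵥ Pi.single j 1, ⟨Pi.single j 1, rfl⟩⟩
  refine ⟨v, b, ?_⟩
  ext i j
  have h := congrFun (congrArg Subtype.val (hb j)) i
  simp only [Matrix.mulVec_single_one] at h
  rw [Matrix.vecMulVec_apply, mul_comm]
  exact h.symm

lemma exists_eq_vecMulVec_star_of_mem_unitDiagRankOne (hn : 1 ≤ n)
    {P : Matrix (Fin n) (Fin n) ℂ} (hP : P ∈ unitDiagRankOne n) :
    ∃ s : Fin n → ℂ, (∀ i, ‖s i‖ = 1) ∧ P = Matrix.vecMulVec s (star s) := by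
  obtain ⟨hpos, hrank, hdiag⟩ := hP
  obtain ⟨a, b, rfl⟩ := exists_eq_vecMulVec_of_rank_eq_one hrank
  let z : Fin n := ⟨0, hn⟩
  have hab : ∀ i, a i * b i = 1 := fun i ↦ hdiag i
  have hh : ∀ i j, star (a j * b i) = a i * b j := fun i j ↦ congrFun (congrFun hpos.1 i) j
  -- The column with index `z` serves as the phase vector, fixing the scaling ambiguity between `a`
  -- and `b`.
  have hs : ∀ i j, a i * b j = a i * b z * star (a j * b z) := by
    intro i j
    rw [hh z j]
    linear_combination (-(a i * b j)) * hab z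
  refine ⟨fun i ↦ a i * b z, fun i ↦ ?_, ?_⟩
  · have h := hs i i
    rw [hab i, RCLike.star_def, Complex.mul_conj'] at h
    have h2 : ‖a i * b z‖ ^ 2 = 1 := by exact_mod_cast h.symm
    exact (pow_eq_one_iff_of_nonneg (norm_nonneg _) two_ne_zero).1 h2
  · ext i j
    exact hs i j

variable {ι κ : Type*} [Fintype ι] [Fintype κ]

/-- A linear functional on matrices given by finitely many quadratic forms which is at most `K`
on the extremal matrices is at most `K` on `setR n`. -/
lemma sum_quadForm_le_of_mem_setR (a : κ → Fin n → ℂ) {K : ℝ}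
    (h : ∀ P ∈ unitDiagRankOne n, ∑ k, (star (a k) ⬝ᵥ (P *ᵥ a k)).re ≤ K)
    {R : Matrix (Fin n) (Fin n) ℂ} (hR : R ∈ setR n) :
    ∑ k, (star (a k) ⬝ᵥ (R *ᵥ a k)).re ≤ K := by
  have hsub : setR n ⊆ {M | ∑ k, (star (a k) ⬝ᵥ (M *ᵥ a k)).re ≤ K} := by
    refine closedConvexHull_min h ?_ ?_
    · intro M hM N hN s t hs ht hst
      simp only [Set.mem_ofPred_eq] at hM hN ⊢
      have e : ∑ k, (star (a k) ⬝ᵥ ((s • M + t • N) *ᵥ a k)).re =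
          s * ∑ k, (star (a k) ⬝ᵥ (M *ᵥ a k)).re + t * ∑ k, (star (a k) ⬝ᵥ (N *ᵥ a k)).re := by
        simp [Matrix.add_mulVec, Matrix.smul_mulVec, Finset.sum_add_distrib, Finset.mul_sum]
      rw [e]
      calc _ ≤ s * K + t * K := add_le_add (mul_le_mul_of_nonneg_left hM hs)
            (mul_le_mul_of_nonneg_left hN ht)
        _ = K := by rw [← add_mul, hst, one_mul]
    · refine isClosed_le (continuous_finsetSum _ fun k _ ↦ Complex.continuous_re.comp ?_)
        continuous_const
      exact Continuous.dotProduct continuous_const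
        (Continuous.matrix_mulVec continuous_id continuous_const)
  exact hsub hR

/-- Pair the sum `U` with itself: `‖U‖² ≤ ∑ qᵢ|⟪U, yᵢ⟫| ≤ K‖U‖`. -/
lemma norm_sum_smul_le {y : Fin n → EuclideanSpace ℂ ι} {q : Fin n → ℝ} (hq : ∀ i, 0 ≤ q i)
    {K : ℝ} (hK0 : 0 ≤ K) (hK : ∀ w, ∑ i, q i * ‖inner ℂ w (y i)‖ ≤ K * ‖w‖) {s : Fin n → ℂ}
    (hs : ∀ i, ‖s i‖ = 1) : ‖∑ i, ((q i : ℂ) * s i) • y i‖ ≤ K := by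
  set U := ∑ i, ((q i : ℂ) * s i) • y i with hU
  have h : ‖U‖ ^ 2 ≤ K * ‖U‖ := by
    refine le_trans ?_ (hK U)
    have e : ‖U‖ ^ 2 = ‖inner ℂ U U‖ := by
      rw [inner_self_eq_ofReal_norm_sq, Complex.norm_real, Real.norm_of_nonneg (by positivity)]
    rw [e]
    conv_lhs => rw [hU, inner_sum]
    refine (norm_sum_le _ _).trans (le_of_eq (Finset.sum_congr rfl fun i _ ↦ ?_))
    rw [inner_smul_right, norm_mul, norm_mul, hs, Complex.norm_real, Real.norm_of_nonneg (hq i),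
      mul_one]
  rcases (norm_nonneg U).eq_or_lt with h0 | h0
  · rwa [← h0]
  · nlinarith

/-- Testing a Gram matrix against itself. -/
lemma sq_sum_mul_norm_sq_le {y : Fin n → EuclideanSpace ℂ ι} (q : Fin n → ℝ) :
    (∑ i, q i * ‖y i‖ ^ 2) ^ 2 ≤ Fintype.card ι *
      ∑ k, (star (fun i ↦ (q i : ℂ) * star (y i k)) ⬝ᵥ
        (Matrix.gram ℂ y *ᵥ fun i ↦ (q i : ℂ) * star (y i k))).re := by
  have h1 : ∑ i, q i * ‖y i‖ ^ 2 = ∑ k, ∑ i, q i * ‖y i k‖ ^ 2 := by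
    rw [Finset.sum_comm]
    refine Finset.sum_congr rfl fun i _ ↦ ?_
    rw [← Finset.mul_sum, EuclideanSpace.norm_sq_eq]
  rw [h1]
  refine (sq_sum_le_card_mul_sum_sq).trans ?_
  rw [Finset.card_univ]
  gcongr with k
  rw [Matrix.star_dotProduct_gram_mulVec, inner_self_eq_ofReal_norm_sq, Complex.ofReal_re,
    EuclideanSpace.norm_sq_eq]
  -- After Cauchy–Schwarz over `k`, only coordinate `k` of the `k`-th test vector sum is kept.
  refine le_trans (le_of_eq ?_) (Finset.single_le_sum (fun l _ ↦ by positivity)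
    (Finset.mem_univ k))
  have e : (∑ i, ((q i : ℂ) * star (y i k)) • y i) k = ((∑ i, q i * ‖y i k‖ ^ 2 : ℝ) : ℂ) := by
    simp [mul_assoc, Complex.conj_mul']
  rw [e, Complex.norm_real, Real.norm_eq_abs, sq_abs]

/-- On an extremal matrix `s s*` the test forms add up to `‖∑ qᵢ sᵢ yᵢ‖²`, hence to at most `K²`,
and this bound passes to `R`. -/
lemma sq_sum_mul_norm_sq_le_of_gram_le (hn : 1 ≤ n) {c : ℝ} (hc : 0 ≤ c)
    {y : Fin n → EuclideanSpace ℂ ι} {q : Fin n → ℝ} (hq : ∀ i, 0 ≤ q i) {K : ℝ} (hK0 : 0 ≤ K)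
    (hK : ∀ w, ∑ i, q i * ‖inner ℂ w (y i)‖ ≤ K * ‖w‖)
    {R : Matrix (Fin n) (Fin n) ℂ} (hR : R ∈ setR n) (hle : Matrix.gram ℂ y ≤ c • R) :
    (∑ i, q i * ‖y i‖ ^ 2) ^ 2 ≤ Fintype.card ι * (c * K ^ 2) := by
  refine (sq_sum_mul_norm_sq_le q).trans ?_
  gcongr
  let a : ι → Fin n → ℂ := fun k i ↦ (q i : ℂ) * star (y i k)
  have h1 : ∑ k, (star (a k) ⬝ᵥ (R *ᵥ a k)).re ≤ K ^ 2 := by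
    refine sum_quadForm_le_of_mem_setR a (fun P hP ↦ ?_) hR
    obtain ⟨s, hs, rfl⟩ := exists_eq_vecMulVec_star_of_mem_unitDiagRankOne hn hP
    have e : ∑ k, (star (a k) ⬝ᵥ (Matrix.vecMulVec s (star s) *ᵥ a k)).re =
        ‖∑ i, ((q i : ℂ) * s i) • y i‖ ^ 2 := by
      rw [EuclideanSpace.norm_sq_eq]
      refine Finset.sum_congr rfl fun k _ ↦ ?_
      rw [dotProduct_mulVec_vecMulVec_star, Complex.ofReal_re]
      congr 2
      simp only [a, WithLp.ofLp_sum, Finset.sum_apply, PiLp.smul_apply, smul_eq_mul]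
      refine Finset.sum_congr rfl fun i _ ↦ ?_
      simp
      ring
    rw [e]
    exact pow_le_pow_left₀ (norm_nonneg _) (norm_sum_smul_le hq hK0 hK hs) 2
  have h2 : ∀ k, (star (a k) ⬝ᵥ (Matrix.gram ℂ y *ᵥ a k)).re ≤
      c * (star (a k) ⬝ᵥ (R *ᵥ a k)).re := by
    intro k
    have := (Complex.le_def.1 ((Matrix.le_iff.1 hle).dotProduct_mulVec_nonneg (a k))).1
    rw [Matrix.sub_mulVec, Matrix.smul_mulVec, dotProduct_sub, dotProduct_smul, Complex.sub_re,
      Complex.real_smul, Complex.re_ofReal_mul, Complex.zero_re] at this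
    linarith
  calc _ ≤ ∑ k, c * (star (a k) ⬝ᵥ (R *ᵥ a k)).re := Finset.sum_le_sum fun k _ ↦ h2 k
    _ ≤ c * K ^ 2 := by
      rw [← Finset.mul_sum]
      exact mul_le_mul_of_nonneg_left h1 hc

lemma gram_mem_setD {y : Fin n → EuclideanSpace ℂ ι} (hy : ∀ i, ‖y i‖ ≤ 1) :
    Matrix.gram ℂ y ∈ setD n := by
  refine ⟨Matrix.posSemidef_gram ℂ y, fun i ↦ ?_⟩
  rw [Matrix.gram_apply, inner_self_eq_ofReal_norm_sq]
  exact_mod_cast pow_le_one₀ (norm_nonneg _) (hy i)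

end

/-! ### Lower bound: discretised Gaussian vectors in high dimension -/

section

variable {ι : Type*} [Fintype ι]

/-- The fibre over 0 may have infinite measure; `g 0 = 0` removes it. -/
lemma integral_comp_simpleFunc {E : Type*} [NormedAddCommGroup E] [MeasurableSpace E]
    {μ : Measure E} {f : SimpleFunc E E} (hf : Integrable f μ) {g : E → ℝ}
    (hg : g 0 = 0) : ∫ x, g (f x) ∂μ =
    ∑ i : Fin f.range.card,
      μ.real (f ⁻¹' {(f.range.equivFin.symm i : E)}) *
      g (f.range.equivFin.symm i) := by
  have h1 := SimpleFunc.map_integral f g hf hg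
  rw [SimpleFunc.integral_eq_integral _ ((SimpleFunc.integrable_iff_finMeasSupp.1 hf).map hg
    |> SimpleFunc.integrable_iff_finMeasSupp.2)] at h1
  simp only [SimpleFunc.map_apply, smul_eq_mul] at h1
  rw [h1, ← Finset.sum_coe_sort]
  exact (Equiv.sum_comp f.range.equivFin.symm
    fun z : f.range ↦ μ.real (f ⁻¹' {(z : E)}) * g z).symm

/-- A domination constant valid for all matrices controls the mean norm of Gaussian vectors. -/
lemma integral_norm_stdGaussian_le_of_domination {c : ℝ} (hc : 0 < c)
    (h : ∀ n : ℕ, 1 ≤ n → ∀ D ∈ setD n, ∃ R ∈ setR n, D ≤ c • R) :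
    ∫ x, ‖x‖ ∂(stdGaussian (EuclideanSpace ℂ ι)) ≤
      √(Fintype.card ι * c) * √(Real.pi / 2) := by
  set γ := stdGaussian (EuclideanSpace ℂ ι)
  set κ := √(Real.pi / 2)
  have hid : Integrable (fun x ↦ x) γ := (memLp_stdGaussian 1 (by simp)).integrable le_rfl
  have hA : ∀ δ : ℝ, 0 < δ → ∫ x, ‖x‖ ∂γ - δ ≤ √(Fintype.card ι * c) * (κ + δ) := by
    intro δ hδ
    obtain ⟨f, hfi, hf⟩ : ∃ f : SimpleFunc (EuclideanSpace ℂ ι) (EuclideanSpace ℂ ι),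
        Integrable f γ ∧ ∫ x, ‖f x - x‖ ∂γ < δ := by
      have ht := tendsto_integral_norm_approxOn_sub (μ := γ) (f := fun x ↦ x) measurable_id hid
      obtain ⟨N, hN⟩ := (ht.eventually_lt_const hδ).exists
      exact ⟨_, SimpleFunc.integrable_approxOn_range measurable_id hid N, hN⟩
    have hfd : Integrable (fun x ↦ ‖f x - x‖) γ := (hfi.sub hid).norm
    set n := f.range.card
    let x : Fin n → EuclideanSpace ℂ ι := fun i ↦ f.range.equivFin.symm i
    let p : Fin n → ℝ := fun i ↦ γ.real (f ⁻¹' {x i})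
    have hsum : ∀ g : EuclideanSpace ℂ ι → ℝ, g 0 = 0 →
        ∫ x, g (f x) ∂γ = ∑ i, p i * g (x i) :=
      fun g hg ↦ integral_comp_simpleFunc hfi hg
    have hn : 1 ≤ n := Finset.card_pos.2 ⟨f 0, SimpleFunc.mem_range_self f 0⟩
    have hp : ∀ i, 0 ≤ p i := fun i ↦ measureReal_nonneg
    let y : Fin n → EuclideanSpace ℂ ι := fun i ↦ (‖x i‖⁻¹ : ℂ) • x i
    have hyn : ∀ i, ‖x i‖ * ‖y i‖ = ‖x i‖ := by
      intro i
      by_cases hx : ‖x i‖ = 0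
      · simp [hx]
      · simp only [y, norm_smul, norm_inv, Complex.norm_real, norm_norm]
        field_simp
    have hy : ∀ i, ‖y i‖ ≤ 1 := by
      intro i
      simp only [y, norm_smul, norm_inv, Complex.norm_real, norm_norm]
      exact inv_mul_le_one
    have hyw : ∀ w i, ‖x i‖ * ‖inner ℂ w (y i)‖ = ‖inner ℂ w (x i)‖ := by
      intro w i
      by_cases hx : ‖x i‖ = 0
      · rw [hx, norm_eq_zero.1 hx]; simp
      · simp only [y, inner_smul_right, norm_mul, norm_inv, Complex.norm_real, norm_norm]
        field_simp
    obtain ⟨R, hR, hle⟩ := h n hn _ (gram_mem_setD hy)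
    have hK : ∀ w, ∑ i, p i * ‖x i‖ * ‖inner ℂ w (y i)‖ ≤ (κ + δ) * ‖w‖ := by
      intro w
      simp_rw [mul_assoc, hyw]
      rw [← hsum (fun z ↦ ‖inner ℂ w z‖) (by simp)]
      have hpt : ∀ z, ‖inner ℂ w (f z)‖ ≤ ‖inner ℂ w z‖ + ‖w‖ * ‖f z - z‖ := by
        intro z
        have : inner ℂ w (f z) = inner ℂ w z + inner ℂ w (f z - z) := by
          rw [← inner_add_right, add_sub_cancel]
        rw [this]
        exact (norm_add_le _ _).trans (add_le_add_right (norm_inner_le_norm _ _) _)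
      have hi := (integrable_inner_stdGaussian w).norm
      have := integral_mono (μ := γ) (hfi.const_inner w).norm
        (hi.add (hfd.const_mul ‖w‖)) hpt
      rw [integral_add' hi (hfd.const_mul ‖w‖), integral_norm_inner_stdGaussian,
        integral_const_mul] at this
      nlinarith [norm_nonneg w]
    have hκδ : 0 ≤ κ + δ := by positivity
    have hmain := sq_sum_mul_norm_sq_le_of_gram_le hn hc.le
      (fun i ↦ mul_nonneg (hp i) (norm_nonneg (x i))) hκδ hK hR hle
    have e : ∑ i, p i * ‖x i‖ * ‖y i‖ ^ 2 = ∫ z, ‖f z‖ ∂γ := by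
      rw [hsum (fun z ↦ ‖z‖) norm_zero]
      refine Finset.sum_congr rfl fun i _ ↦ ?_
      rw [pow_two, mul_assoc, ← mul_assoc ‖x i‖, hyn, hyn]
    rw [e] at hmain
    have hlow : ∫ z, ‖z‖ ∂γ - δ ≤ ∫ z, ‖f z‖ ∂γ := by
      have hpt : ∀ z, ‖z‖ ≤ ‖f z‖ + ‖f z - z‖ := by
        intro z
        have := norm_sub_le (f z) (f z - z)
        rwa [sub_sub_cancel] at this
      have := integral_mono (μ := γ) hid.norm (hfi.norm.add hfd) hpt
      rw [integral_add' hfi.norm hfd] at this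
      linarith
    refine hlow.trans ?_
    rw [← Real.sqrt_sq hκδ, ← Real.sqrt_mul (by positivity)]
    refine Real.le_sqrt_of_sq_le (hmain.trans (le_of_eq (by ring)))
  have hlim : Filter.Tendsto (fun δ : ℝ ↦ √(Fintype.card ι * c) * (κ + δ) + δ)
      (nhdsWithin 0 (Set.Ioi 0)) (nhds (√(Fintype.card ι * c) * (κ + 0) + 0)) := by
    refine Filter.Tendsto.mono_left ?_ nhdsWithin_le_nhds
    exact Continuous.tendsto (by fun_prop) 0
  rw [add_zero, add_zero] at hlim
  refine ge_of_tendsto hlim ?_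
  filter_upwards [self_mem_nhdsWithin] with δ hδ
  linarith [hA δ hδ]

lemma four_div_pi_le_of_domination {c : ℝ} (hc : 0 < c)
    (h : ∀ n : ℕ, 1 ≤ n → ∀ D ∈ setD n, ∃ R ∈ setR n, D ≤ c • R) : 4 / Real.pi ≤ c := by
  set V := Var[fun t ↦ t ^ 2; gaussianReal 0 1]
  -- Concentration in real dimension `2(d + 1)` meets the domination bound; the common factor `√(d +
  -- 1)` cancels.
  have key : ∀ d : ℕ, √2 * (1 - V / 4 * (1 / ((d : ℝ) + 1))) ≤ √c * √(Real.pi / 2) := by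
    intro d
    have h1 := integral_norm_stdGaussian_le_of_domination (ι := Fin (d + 1)) hc h
    have hfr : Module.finrank ℝ (EuclideanSpace ℂ (Fin (d + 1))) = 2 * (d + 1) := by
      rw [← Module.finrank_mul_finrank ℝ ℂ, Complex.finrank_real_complex, finrank_euclideanSpace,
        Fintype.card_fin]
    have h2 := sqrt_finrank_mul_le_integral_norm_stdGaussian
      (EuclideanSpace ℂ (Fin (d + 1))) (by rw [hfr]; positivity)
    have h3 := h2.trans h1
    have hd : (0 : ℝ) < (d : ℝ) + 1 := by positivity
    rw [hfr, Fintype.card_fin] at h3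
    push_cast at h3
    rw [Real.sqrt_mul (by norm_num), Real.sqrt_mul hd.le] at h3
    refine le_of_mul_le_mul_left (a := √((d : ℝ) + 1)) ?_ (Real.sqrt_pos.2 hd)
    refine le_trans (le_of_eq ?_) (h3.trans (le_of_eq (by ring)))
    field_simp
    ring
  have hlim : Filter.Tendsto (fun d : ℕ ↦ √2 * (1 - V / 4 * (1 / ((d : ℝ) + 1))))
      Filter.atTop (nhds (√2 * (1 - V / 4 * 0))) :=
    ((tendsto_one_div_add_atTop_nhds_zero_nat.const_mul _).const_sub _).const_mul _
  have h2 := le_of_tendsto' hlim key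
  rw [mul_zero, sub_zero, mul_one, ← Real.sqrt_mul hc.le, Real.sqrt_le_sqrt_iff (by positivity)]
    at h2
  rw [div_le_iff₀ Real.pi_pos]
  linarith

end

theorem proposition1p2 :
    IsLeast {c : ℝ | 0 < c ∧ ∀ n : ℕ, 1 ≤ n → ∀ D ∈ setD n, ∃ R ∈ setR n, D ≤ c • R}
      (4 / Real.pi) :=
  ⟨⟨by positivity, fun _ hn _ hD ↦ exists_mem_setR_le_smul hn hD⟩,
    fun _ hc ↦ four_div_pi_le_of_domination hc.1 hc.2⟩
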